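/- **Setting.** Let $(\Delta,\mathcal D,\mathbb P)$ be a probability space (for instance $\Delta\subseteq\mathbb R^{n}$ with a $\sigma$-algebra $\mathcal D$). Elements of $\mathcal D$ are called concepts or hypotheses. Fix a target concept $T\in\mathcal D$ and let $d_{\mathbb P}(T,H)=\mathbb P\{\delta:\mathbb 1_H(\delta)\neq\mathbb 1_T(\delta)\}$. For $\delta=(\delta_1,\dots,\delta_m)\in\Delta^m$ and $J\subseteq\{1,\dots,m\}$, a hypothesis $H$ is consistent with the samples in $J$ if $\mathbb 1_H(\delta_i)=\mathbb 1_T(\delta_i)$ for all $i\in J$. Fix $d,r\in\mathbb N$ and a map $G_d:[\Delta\times\{0,1\}]^d\to\mathcal D$ such that $\{(x,\delta)\in\Delta^d\times\Delta:\delta\in G_d((x_k,\mathbb 1_T(x_k))_{k=1}^d)\}$ is measurable. For a set $I\subseteq\{1,\dots,m\}$ of $d$ indices put $H_I=G_d\big((\delta_i,\mathbb 1_T(\delta_i))_{i\in I}\big)$, the indices being listed in increasing order. For a set $R\subseteq\{1,\dots,m\}$ of $r$ indices, say that $I$ *compresses the samples outside $R$* if $I$ is a set of $d$ indices in $\{1,\dots,m\}\setminus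 R$ and $H_I$ is consistent with the samples in $\{1,\dots,m\}\setminus R$. **Assumption (relaxed consistency with a unique compression set).** For every $m\ge d+r$: 1. for all $\delta\in\Delta^m$, all $R$ with $|R|=r$ and all $I\subseteq\{1,\dots,m\}\setminus R$ with $|I|=d$, $H_I$ is consistent with the samples in $I$; 2. with $\mathbb P^m$-probability one, for every $R$ with $|R|=r$ there is an $I$ that compresses the samples outside $R$, and this $I$ is unique; 3. with $\mathbb P^m$-probability one, there is an $R$ with $|R|=r$ such that for every $I$ that compresses the samples outside $R$, $\mathbb 1_{H_I}(\delta_i)\ne\mathbb 1_T(\delta_i)$ for each $i\in R$. **Sample-and-discard algorithm.** This is a family of maps $A_m:[\Delta\times\{0,1\}]^m\to\mathcal D$, $m\ge d+r$, such that, on every labeled multisample $((\delta_i,\mathbb 1_T(\delta_i)))_{i=1}^m$ for which an $I$ as in 2 exists for every $R$ and an $R$ as in 3 exists, $A_m$ returns $H_m=H_I$ for some $I$ for which there is an $R$ with $|R|=r$ such that $I$ compresses the samples outside $R$ and $\mathbb 1_{H_I}(\delta_i)\neq\mathbb 1_T(\delta_i)$ for each $i\in R$. On other multisamples the output is arbitrary.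 **Theorem.** Under the Assumption, such algorithms exist, and every such algorithm $\{A_m\}_{m\ge d+r}$ satisfies, for all $\epsilon\in(0,1)$ and all $m\ge d+r$, $$\mathbb P^m\{\delta\in\Delta^m:\ d_{\mathbb P}(T,H_m)>\epsilon\}\ \le\ q(m,\epsilon):=\binom{r+d-1}{r}\sum_{i=0}^{r+d-1}\binom{m}{i}\epsilon^i(1-\epsilon)^{m-i},$$ where $\lim_{m\to\infty}q(m,\epsilon)=0$ for every $\epsilon\in(0,1)$. In particular $\{A_m\}_{m\ge d+r}$ is PAC-T: there is a function $\bar q:\mathbb N\times(0,1)\to[0,1]$ with $\lim_{m\to\infty}\bar q(m,\epsilon)=0$ and $\mathbb P^m\{d_{\mathbb P}(T,H_m)>\epsilon\}\le\bar q(m,\epsilon)$ for all $\epsilon\in(0,1)$, $m\ge d+r$. (Here $\mathbb P^m$ of a set that is not measurable is read as its outer measure. If $r+d=0$, then $\binom{r+d-1}{r}$ is read as $1$ and the sum is empty.) -/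

import Mathlib

open MeasureTheory Filter Topology Set

namespace CompressionLearning

noncomputable section

/-- Concepts (and hypotheses): the measurable subsets of `Δ`. -/
abbrev Concept (Δ : Type*) [MeasurableSpace Δ] := {C : Set Δ // MeasurableSet C}

variable {Δ : Type*} [MeasurableSpace Δ]

open Classical in
/-- The indicator function of a concept, with values in `{0,1}` (here `Bool`). -/
def label (C : Concept Δ) (x : Δ) : Bool := decide (x ∈ C.1)

/-- The labeled `m`-multisample `(δ_i, 1_T(δ_i))_{i}`. -/
def labeled (T : Concept Δ) {m : ℕ} (δ : Fin m → Δ) : Fin m → Δ × Bool :=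
  fun i => (δ i, label T (δ i))

/-- `H` is consistent with those labeled samples `z i` for which `i ∈ J`. -/
def ConsistentOn (H : Concept Δ) {m : ℕ} (z : Fin m → Δ × Bool) (J : Finset (Fin m)) : Prop :=
  ∀ i ∈ J, label H (z i).1 = (z i).2

/-- The error `d_P(T,H)`: the probability that `H` and `T` give different labels. -/
def err (P : Measure Δ) (T H : Concept Δ) : ℝ := P.real {x | label H x ≠ label T x}

/-- An algorithm: a family of maps from labeled `m`-multisamples to hypotheses. When it is indexed
by `m ≥ m₀`, its values at smaller `m` are never looked at. -/
abbrev Algorithm (Δ : Type*) [MeasurableSpace Δ] :=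
  (m : ℕ) → (Fin m → Δ × Bool) → Concept Δ

/-- `P^m {(δ_1, …, δ_m) : d_P(T, A_m((δ_i, 1_T(δ_i))_i)) > ε}`. -/
def errProb (P : Measure Δ) (T : Concept Δ) (A : Algorithm Δ) (m : ℕ) (ε : ℝ) : ℝ :=
  (Measure.pi fun _ : Fin m => P).real {δ : Fin m → Δ | ε < err P T (A m (labeled T δ))}

/-- The algorithm `(A_m)_{m ≥ m₀}` is Probably Approximately Correct for the target concept `T`. -/
def IsPACT (P : Measure Δ) (T : Concept Δ) (m₀ : ℕ) (A : Algorithm Δ) : Prop :=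
  ∃ q : ℕ → ℝ → ℝ, (∀ m, ∀ ε ∈ Ioo (0 : ℝ) 1, q m ε ∈ Icc (0 : ℝ) 1) ∧
    (∀ ε ∈ Ioo (0 : ℝ) 1, Tendsto (fun m => q m ε) atTop (𝓝 0)) ∧
    ∀ ε ∈ Ioo (0 : ℝ) 1, ∀ m, m₀ ≤ m → errProb P T A m ε ≤ q m ε

/-- The sets of `k` indices from `{1, …, m}`. -/
abbrev IdxSet (m k : ℕ) := {I : Finset (Fin m) // I.card = k}

/-- The hypothesis `H_I`: the compression map `G` applied to the labeled samples with index
in `I`, listed in increasing order of the index. -/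
def hyp {d : ℕ} (G : (Fin d → Δ × Bool) → Concept Δ) {m : ℕ} (z : Fin m → Δ × Bool)
    (I : IdxSet m d) : Concept Δ :=
  G fun k => z (I.1.orderEmbOfFin I.2 k)

/-- `I` is a set of `d` indices outside `R`, and `H_I` is consistent with all labeled samples
whose index is outside `R`. -/
def Compresses {d r : ℕ} (G : (Fin d → Δ × Bool) → Concept Δ) {m : ℕ} (z : Fin m → Δ × Bool)
    (R : IdxSet m r) (I : IdxSet m d) : Prop :=
  Disjoint I.1 R.1 ∧ ConsistentOn (hyp G z I) z (R.1)ᶜ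

/-- `H_I` is inconsistent with each one of the labeled samples whose index is in `R`. -/
def Violates {d r : ℕ} (G : (Fin d → Δ × Bool) → Concept Δ) {m : ℕ} (z : Fin m → Δ × Bool)
    (R : IdxSet m r) (I : IdxSet m d) : Prop :=
  ∀ i ∈ R.1, label (hyp G z I) (z i).1 ≠ (z i).2

/-- Relaxed consistency of the compression map `G`, with `r` discarded samples. -/
structure RelaxedConsistency (P : Measure Δ) (T : Concept Δ) (d r : ℕ)
    (G : (Fin d → Δ × Bool) → Concept Δ) : Prop where
  consistent_self : ∀ m, d + r ≤ m → ∀ δ : Fin m → Δ, ∀ R : IdxSet m r, ∀ I : IdxSet m d,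
    Disjoint I.1 R.1 → ConsistentOn (hyp G (labeled T δ) I) (labeled T δ) I.1
  exists_compression : ∀ m, d + r ≤ m → ∀ᵐ δ ∂(Measure.pi fun _ : Fin m => P),
    ∀ R : IdxSet m r, ∃ I : IdxSet m d, Compresses G (labeled T δ) R I
  exists_discard : ∀ m, d + r ≤ m → ∀ᵐ δ ∂(Measure.pi fun _ : Fin m => P),
    ∃ R : IdxSet m r, ∀ I : IdxSet m d, Compresses G (labeled T δ) R I →
      Violates G (labeled T δ) R I

/-- Relaxed consistency with a unique compression set: almost surely, for every set `R` of `r`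
indices there is only one set of `d` indices outside `R` that compresses the samples outside `R`. -/
structure UniqueRelaxedConsistency (P : Measure Δ) (T : Concept Δ) (d r : ℕ)
    (G : (Fin d → Δ × Bool) → Concept Δ) : Prop extends RelaxedConsistency P T d r G where
  unique_compression : ∀ m, d + r ≤ m → ∀ᵐ δ ∂(Measure.pi fun _ : Fin m => P),
    ∀ R : IdxSet m r, ∀ I I' : IdxSet m d,
      Compresses G (labeled T δ) R I → Compresses G (labeled T δ) R I' → I = I'

/-- `A` is a sample-and-discard algorithm built from `G`: on every multisample that has the
properties which relaxed consistency grants almost surely, it returns `H_I` for some set `I` of `d`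
indices such that, for some set `R` of `r` indices, `H_I` is consistent with all the samples
outside `R` and inconsistent with each sample in `R`. On the remaining multisamples its output is
arbitrary, and the choice of `R` and `I` need not be measurable. -/
def IsSampleAndDiscard (T : Concept Δ) (d r : ℕ) (G : (Fin d → Δ × Bool) → Concept Δ)
    (A : Algorithm Δ) : Prop :=
  ∀ m, d + r ≤ m → ∀ δ : Fin m → Δ,
    (∀ R : IdxSet m r, ∃ I : IdxSet m d, Compresses G (labeled T δ) R I) →
    (∃ R : IdxSet m r, ∀ I : IdxSet m d, Compresses G (labeled T δ) R I →
      Violates G (labeled T δ) R I) →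
    ∃ (R : IdxSet m r) (I : IdxSet m d), Compresses G (labeled T δ) R I ∧
      Violates G (labeled T δ) R I ∧ A m (labeled T δ) = hyp G (labeled T δ) I

end

end CompressionLearning

open CompressionLearning

/-! Let `V` be the error of the hypothesis compressed from `d` independent samples. Given the
samples in `I`, the others are independent and each agrees with `H_I` with probability `1 - V`, so a
fixed `I` compresses the samples outside a fixed `R` with probability `E (1 - V)^(m - r - d)`. By
existence and uniqueness these events, over all `I` disjoint from `R`, partition the space up to
null sets. Hence `C(k + d, d) * E (1 - V)^k = 1` for every `k` (`choose_mul_integral_pow`). Moments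
determine a finite measure on `[0,1]`, so for `d ≥ 1` the law of `V` is known exactly: it has
density `d * v^(d-1)` (`map_compAccuracy`).

A bad output forces some pair `(R, I)` for which `H_I` errs on all of `R`, on nothing outside `R`,
and has `V > ε`. The union bound over the pairs (`errProb_le_of_isSampleAndDiscard`) gives `C(m, r)
* C(m - r, d) * E[V^r (1 - V)^(m - r - d); V > ε]`. Under the known law this is an incomplete beta
integral, that is, a multiple of a binomial tail, and the constants collapse to `C(r + d - 1, r)`.
-/

namespace CompressionLearning

/-! ### Binomial tails as incomplete beta integrals -/

/-- The probability that a binomial variable with parameters `N` and `1 - w` is at most `a`. -/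
noncomputable def binomialTail (N a : ℕ) (w : ℝ) : ℝ :=
  ∑ i ∈ Finset.range (a + 1), (N.choose i : ℝ) * (1 - w) ^ i * w ^ (N - i)

/-- Telescoping, by induction on `a` with `a + b` fixed: the derivative of the term of index `a + 1`
has two parts, one cancelling the derivative of the shorter tail (`e1`), the other being the claimed
value (`e2`). -/
theorem hasDerivAt_binomialTail (a b : ℕ) (w : ℝ) :
    HasDerivAt (binomialTail (a + b + 1) a)
      ((a + b + 1 : ℕ) * ((a + b).choose a : ℝ) * ((1 - w) ^ a * w ^ b)) w := by
  induction a generalizing b with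
  | zero =>
    have h : binomialTail (0 + b + 1) 0 = fun w => w ^ (b + 1) := by
      funext w; simp [binomialTail]
    rw [h]
    simpa using hasDerivAt_pow (b + 1) w
  | succ a ih =>
    have h : binomialTail (a + 1 + b + 1) (a + 1) = fun w =>
        binomialTail (a + (b + 1) + 1) a w +
          ((a + 1 + b + 1).choose (a + 1) : ℝ) * (1 - w) ^ (a + 1) * w ^ (b + 1) := by
      funext w
      rw [binomialTail, Finset.sum_range_succ, binomialTail,
        show a + (b + 1) + 1 = a + 1 + b + 1 by ring,
        show a + 1 + b + 1 - (a + 1) = b + 1 by omega]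
    rw [h]
    have h1 : HasDerivAt (fun w : ℝ => (1 - w) ^ (a + 1)) (-((a + 1 : ℕ) * (1 - w) ^ a)) w := by
      simpa using ((hasDerivAt_id' w).const_sub 1).fun_pow (a + 1)
    have h2 : HasDerivAt (fun w : ℝ => w ^ (b + 1)) ((b + 1 : ℕ) * w ^ b) w := by
      simpa using hasDerivAt_pow (b + 1) w
    have e1 : (((a + 1 + b + 1).choose (a + 1) : ℕ) : ℝ) * (a + 1) =
        (a + b + 2) * ((a + (b + 1)).choose a : ℕ) := by
      have := Nat.add_one_mul_choose_eq (a + (b + 1)) a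
      rw [show a + (b + 1) + 1 = a + 1 + b + 1 by ring] at this
      have h' := congrArg (Nat.cast (R := ℝ)) this
      push_cast at h'
      linarith
    have e2 : (((a + 1 + b + 1).choose (a + 1) : ℕ) : ℝ) * (b + 1) =
        (a + b + 2) * ((a + 1 + b).choose (a + 1) : ℕ) := by
      have := Nat.choose_mul_succ_eq (a + 1 + b) (a + 1)
      rw [show a + 1 + b + 1 - (a + 1) = b + 1 by omega] at this
      have h' := congrArg (Nat.cast (R := ℝ)) this
      push_cast at h'
      linarith
    refine ((ih (b + 1)).add
      ((h1.const_mul ((a + 1 + b + 1).choose (a + 1) : ℝ)).mul h2)).congr_deriv ?_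
    push_cast
    linear_combination ((1 - w) ^ (a + 1) * w ^ b) * e2 - ((1 - w) ^ a * w ^ (b + 1)) * e1

theorem binomialTail_zero (a b : ℕ) : binomialTail (a + b + 1) a 0 = 0 := by
  refine Finset.sum_eq_zero fun i hi => ?_
  rw [zero_pow (by have := Finset.mem_range.1 hi; omega), mul_zero]

theorem binomialTail_one (N a : ℕ) : binomialTail N a 1 = 1 := by
  rw [binomialTail, Finset.sum_range_succ']
  simp

theorem integral_one_sub_pow_mul_pow (a b : ℕ) (w : ℝ) :
    (a + b + 1 : ℕ) * ((a + b).choose a : ℝ) * ∫ x in (0 : ℝ)..w, (1 - x) ^ a * x ^ b =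
      binomialTail (a + b + 1) a w := by
  have h := intervalIntegral.integral_eq_sub_of_hasDerivAt
    (fun x _ => hasDerivAt_binomialTail a b x)
    ((by fun_prop : Continuous fun w : ℝ =>
      (a + b + 1 : ℕ) * ((a + b).choose a : ℝ) * ((1 - w) ^ a * w ^ b)).intervalIntegrable 0 w)
  rw [intervalIntegral.integral_const_mul, binomialTail_zero, sub_zero] at h
  exact h

/-! ### The moment problem on the unit interval -/

/-- A finite measure on the unit interval is determined by its moments. -/
theorem measure_unitInterval_ext {μ ν : Measure unitInterval} [IsFiniteMeasure μ]
    [IsFiniteMeasure ν]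
    (h : ∀ k : ℕ, ∫ x : unitInterval, (x : ℝ) ^ k ∂μ = ∫ x : unitInterval, (x : ℝ) ^ k ∂ν) :
    μ = ν := by
  have hint (ρ : Measure unitInterval) [IsFiniteMeasure ρ] (f : C(unitInterval, ℝ)) :
      Integrable f ρ :=
    (BoundedContinuousFunction.mkOfCompact f).integrable ρ
  -- Integration is Lipschitz for the sup norm, with the total mass as constant; equality of
  -- integrals thus passes from polynomials to their closure, which is everything by Weierstrass.
  have hcont (ρ : Measure unitInterval) [IsFiniteMeasure ρ] :
      Continuous fun f : C(unitInterval, ℝ) => ∫ x, f x ∂ρ := by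
    refine (LipschitzWith.of_dist_le_mul (K := (ρ.real univ).toNNReal) fun f g => ?_).continuous
    rw [Real.dist_eq, ← integral_sub (hint ρ f) (hint ρ g),
      Real.coe_toNNReal _ measureReal_nonneg, mul_comm, ← Real.norm_eq_abs]
    refine norm_integral_le_of_norm_le_const (Eventually.of_forall fun x => ?_)
    rw [← dist_eq_norm]
    exact ContinuousMap.dist_apply_le_dist x
  have hpoly (p : Polynomial ℝ) :
      ∫ x : unitInterval, p.eval (x : ℝ) ∂μ = ∫ x : unitInterval, p.eval (x : ℝ) ∂ν := by
    have hp (ρ : Measure unitInterval) [IsFiniteMeasure ρ] :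
        ∫ x : unitInterval, p.eval (x : ℝ) ∂ρ =
          ∑ i ∈ Finset.range (p.natDegree + 1), p.coeff i * ∫ x : unitInterval, (x : ℝ) ^ i ∂ρ := by
      simp_rw [Polynomial.eval_eq_sum_range]
      rw [integral_finsetSum]
      · simp_rw [integral_const_mul]
      · exact fun i _ => hint ρ ⟨fun x => p.coeff i * (x : ℝ) ^ i, by fun_prop⟩
    rw [hp μ, hp ν]
    simp_rw [h]
  have hall (f : C(unitInterval, ℝ)) : ∫ x, f x ∂μ = ∫ x, f x ∂ν := by
    have hcl : IsClosed {f : C(unitInterval, ℝ) | ∫ x, f x ∂μ = ∫ x, f x ∂ν} :=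
      isClosed_eq (hcont μ) (hcont ν)
    refine closure_minimal ?_ hcl (continuousMap_mem_polynomialFunctions_closure 0 1 f)
    rintro _ ⟨p, -, rfl⟩
    simpa using hpoly p
  exact ext_of_forall_integral_eq_of_IsFiniteMeasure fun f => hall f.toContinuousMap

/-- For fixed `i` the binomial coefficient grows at most like `m ^ i`, which the geometric factor
beats. -/
theorem tendsto_choose_mul_pow_mul_pow (i : ℕ) {ε : ℝ} (hε : ε ∈ Ioo (0 : ℝ) 1) :
    Tendsto (fun m : ℕ => (m.choose i : ℝ) * ε ^ i * (1 - ε) ^ (m - i)) atTop (𝓝 0) := by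
  have h0 : 0 < 1 - ε := by linarith [hε.2]
  have hlim : Tendsto (fun m : ℕ => (ε ^ i / (1 - ε) ^ i) * ((m : ℝ) ^ i * (1 - ε) ^ m))
      atTop (𝓝 0) := by
    simpa using (tendsto_pow_const_mul_const_pow_of_abs_lt_one i
      (by rw [abs_of_pos h0]; linarith [hε.1])).const_mul (ε ^ i / (1 - ε) ^ i)
  refine squeeze_zero' (Eventually.of_forall fun m => ?_) ?_ hlim
  · have := hε.1
    positivity
  · filter_upwards [eventually_ge_atTop i] with m hm
    have hc : (m.choose i : ℝ) ≤ (m : ℝ) ^ i := by exact_mod_cast Nat.choose_le_pow m i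
    have hp : (1 - ε) ^ (m - i) = (1 - ε) ^ m / (1 - ε) ^ i := by
      rw [eq_div_iff (by positivity), ← pow_add, Nat.sub_add_cancel hm]
    rw [hp]
    have := hε.1
    calc (m.choose i : ℝ) * ε ^ i * ((1 - ε) ^ m / (1 - ε) ^ i)
        ≤ (m : ℝ) ^ i * ε ^ i * ((1 - ε) ^ m / (1 - ε) ^ i) := by gcongr
      _ = _ := by ring

/-! ### Conditioning on a block of independent coordinates -/

/-- Probability of an event that constrains a block of coordinates and, given that block, each of
the remaining coordinates separately. -/
theorem pi_measure_block {Δ α β ι : Type*} [MeasurableSpace Δ] [Fintype α] [Fintype β] [Fintype ι]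
    (P : Measure Δ) [IsProbabilityMeasure P] (e : α ⊕ β ≃ ι) {B : Set (α → Δ)}
    (hB : MeasurableSet B) {E : β → Set ((α → Δ) × Δ)} (hE : ∀ j, MeasurableSet (E j)) :
    MeasurableSet {δ : ι → Δ | (fun a => δ (e (.inl a))) ∈ B ∧
      ∀ j, ((fun a => δ (e (.inl a))), δ (e (.inr j))) ∈ E j} ∧
    (Measure.pi fun _ : ι => P) {δ : ι → Δ | (fun a => δ (e (.inl a))) ∈ B ∧
      ∀ j, ((fun a => δ (e (.inl a))), δ (e (.inr j))) ∈ E j} =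
    ∫⁻ x in B, ∏ j, P (Prod.mk x ⁻¹' E j) ∂(Measure.pi fun _ : α => P) := by
  have hmp : MeasurePreserving
      (fun δ : ι → Δ => ((fun a => δ (e (.inl a))), (fun j => δ (e (.inr j)))))
      (Measure.pi fun _ : ι => P)
      ((Measure.pi fun _ : α => P).prod (Measure.pi fun _ : β => P)) :=
    (measurePreserving_sumPiEquivProdPi (fun _ : α ⊕ β => P)).comp
      (measurePreserving_piCongrLeft (fun _ : ι => P) e).symm
  let S : Set ((α → Δ) × (β → Δ)) := {p | p.1 ∈ B ∧ ∀ j, (p.1, p.2 j) ∈ E j}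
  have hS : MeasurableSet S := by
    have h : S = Prod.fst ⁻¹' B ∩
        ⋂ j, (fun p : (α → Δ) × (β → Δ) => (p.1, p.2 j)) ⁻¹' E j := by
      ext p
      simp [S]
    rw [h]
    exact (measurable_fst hB).inter (MeasurableSet.iInter fun j =>
      (by fun_prop : Measurable fun p : (α → Δ) × (β → Δ) => (p.1, p.2 j)) (hE j))
  refine ⟨hmp.measurable hS, (hmp.measure_preimage hS.nullMeasurableSet).trans ?_⟩
  -- Fubini: for `x` in `B` the section of `S` is a box, for other `x` it is empty.
  rw [Measure.prod_apply hS, ← lintegral_indicator hB]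
  refine lintegral_congr fun x => ?_
  by_cases hx : x ∈ B
  · rw [indicator_of_mem hx, ← Measure.pi_pi]
    congr 1
    ext y
    simp [S, hx]
  · rw [indicator_of_notMem hx]
    convert measure_empty (μ := Measure.pi fun _ : β => P)
    ext y
    simp [S, hx]

variable {Δ : Type*} [MeasurableSpace Δ]

theorem measureReal_pi_block {α β ι : Type*} [Fintype α] [Fintype β] [Fintype ι]
    (P : Measure Δ) [IsProbabilityMeasure P] (e : α ⊕ β ≃ ι) {B : Set (α → Δ)}
    (hB : MeasurableSet B) {E : β → Set ((α → Δ) × Δ)} (hE : ∀ j, MeasurableSet (E j)) :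
    (Measure.pi fun _ : ι => P).real {δ : ι → Δ | (fun a => δ (e (.inl a))) ∈ B ∧
      ∀ j, ((fun a => δ (e (.inl a))), δ (e (.inr j))) ∈ E j} =
    ∫ x in B, ∏ j, P.real (Prod.mk x ⁻¹' E j) ∂(Measure.pi fun _ : α => P) := by
  rw [measureReal_def, (pi_measure_block P e hB hE).2, ← integral_toReal]
  · simp_rw [ENNReal.toReal_prod, measureReal_def]
  · exact (Finset.measurable_prod _ fun j _ => measurable_measure_prodMk_left (hE j)).aemeasurable
  · exact Eventually.of_forall fun x => ENNReal.prod_lt_top fun j _ => measure_lt_top P _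

/-! ### Probabilities of compression and violation for fixed index sets -/

/-- The pairs of a compression sample and a point on which the compressed hypothesis errs. -/
def disagreement {d : ℕ} (T : Concept Δ) (G : (Fin d → Δ × Bool) → Concept Δ) :
    Set ((Fin d → Δ) × Δ) :=
  {p | label (G (labeled T p.1)) p.2 ≠ label T p.2}

theorem measurableSet_disagreement {d : ℕ} {T : Concept Δ} {G : (Fin d → Δ × Bool) → Concept Δ}
    (hmeas : MeasurableSet {p : (Fin d → Δ) × Δ | p.2 ∈ (G (labeled T p.1)).1}) :
    MeasurableSet (disagreement T G) := by
  have hT : MeasurableSet {p : (Fin d → Δ) × Δ | p.2 ∈ T.1} := measurable_snd T.2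
  convert (hmeas.diff hT).union (hT.diff hmeas) using 1
  ext p
  simp only [disagreement, label, mem_ofPred_eq, ne_eq, decide_eq_decide, mem_union, Set.mem_sdiff]
  tauto

/-- The error of the hypothesis compressed from the sample `x`. -/
noncomputable def compErr {d : ℕ} (P : Measure Δ) (T : Concept Δ)
    (G : (Fin d → Δ × Bool) → Concept Δ) (x : Fin d → Δ) : ℝ :=
  err P T (G (labeled T x))

section

variable {d r : ℕ} {P : Measure Δ} {T : Concept Δ}
  {G : (Fin d → Δ × Bool) → Concept Δ}

theorem compErr_nonneg (x : Fin d → Δ) : 0 ≤ compErr P T G x := measureReal_nonneg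

/-- List the indices in `I` increasingly and keep the other indices as they are. -/
def IdxSet.splitEquiv {m : ℕ} (I : IdxSet m d) : Fin d ⊕ {i // i ∉ I.1} ≃ Fin m :=
  (Equiv.sumCongr (I.1.orderIsoOfFin I.2).toEquiv (Equiv.refl _)).trans
    (Equiv.sumCompl (· ∈ I.1))

/-- Consistency on `I` itself is automatic by `consistent_self`, so only the `m - r - d` indices
outside both `I` and `R` impose a condition. -/
theorem compresses_iff {m : ℕ} (hm : d + r ≤ m) (hG : RelaxedConsistency P T d r G)
    {R : IdxSet m r} {I : IdxSet m d} (hRI : Disjoint I.1 R.1) (δ : Fin m → Δ) :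
    Compresses G (labeled T δ) R I ↔ ∀ j : {i // i ∉ I.1}, j.1 ∉ R.1 →
      ((fun a => δ (I.splitEquiv (.inl a))), δ (I.splitEquiv (.inr j))) ∈
        (disagreement T G)ᶜ := by
  have key (i : Fin m) : ((fun a => δ (I.splitEquiv (.inl a))), δ i) ∈ (disagreement T G)ᶜ ↔
      label (hyp G (labeled T δ) I) (labeled T δ i).1 = (labeled T δ i).2 := by
    rw [mem_compl_iff]
    exact not_not
  constructor
  · exact fun h j hj => (key j.1).2 (h.2 j.1 (by simpa using hj))
  · refine fun h => ⟨hRI, fun i hi => ?_⟩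
    by_cases hiI : i ∈ I.1
    · exact hG.consistent_self m hm δ R I hRI i hiI
    · exact (key i).1 (h ⟨i, hiI⟩ (by simpa using hi))

variable [IsProbabilityMeasure P]

theorem compErr_le_one (x : Fin d → Δ) : compErr P T G x ≤ 1 := measureReal_le_one

theorem measurable_compErr (hD : MeasurableSet (disagreement T G)) :
    Measurable (compErr P T G) :=
  (measurable_measure_prodMk_left hD).ennreal_toReal

theorem measureReal_disagreement_compl (hD : MeasurableSet (disagreement T G)) (x : Fin d → Δ) :
    P.real (Prod.mk x ⁻¹' (disagreement T G)ᶜ) = 1 - compErr P T G x := by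
  rw [preimage_compl, probReal_compl_eq_one_sub (measurable_prodMk_left hD)]
  rfl

theorem prod_ite_mem_of_disjoint {m : ℕ} {R : IdxSet m r} {I : IdxSet m d}
    (hRI : Disjoint I.1 R.1) (u v : ℝ) :
    ∏ j : {i // i ∉ I.1}, (if j.1 ∈ R.1 then u else v) = u ^ r * v ^ (m - r - d) := by
  classical
  rw [← Finset.prod_subtype (I.1)ᶜ (by simp) (fun i => if i ∈ R.1 then u else v), Finset.prod_ite,
    Finset.prod_const, Finset.prod_const]
  have h1 : (I.1)ᶜ.filter (· ∈ R.1) = R.1 := by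
    ext i
    have : i ∈ R.1 → i ∉ I.1 := fun h => Finset.disjoint_right.1 hRI h
    simp only [Finset.mem_filter, Finset.mem_compl]
    tauto
  have h2 := Finset.card_filter_add_card_filter_not (s := (I.1)ᶜ) (· ∈ R.1)
  rw [h1, R.2, Finset.card_compl, Fintype.card_fin, I.2] at h2
  rw [h1, R.2]
  congr 2
  omega

theorem measure_compresses {m : ℕ} (hm : d + r ≤ m) (hG : RelaxedConsistency P T d r G)
    (hD : MeasurableSet (disagreement T G))
    {R : IdxSet m r} {I : IdxSet m d} (hRI : Disjoint I.1 R.1) :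
    MeasurableSet {δ : Fin m → Δ | Compresses G (labeled T δ) R I} ∧
    (Measure.pi fun _ : Fin m => P).real {δ | Compresses G (labeled T δ) R I} =
      ∫ x, (1 - compErr P T G x) ^ (m - r - d) ∂(Measure.pi fun _ : Fin d => P) := by
  classical
  let E : {i // i ∉ I.1} → Set ((Fin d → Δ) × Δ) :=
    fun j => if j.1 ∈ R.1 then univ else (disagreement T G)ᶜ
  have hE (j) : MeasurableSet (E j) := by
    dsimp only [E]
    split_ifs
    exacts [MeasurableSet.univ, hD.compl]
  have hset : {δ : Fin m → Δ | Compresses G (labeled T δ) R I} =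
      {δ | (fun a => δ (I.splitEquiv (.inl a))) ∈ (univ : Set (Fin d → Δ)) ∧
        ∀ j, ((fun a => δ (I.splitEquiv (.inl a))), δ (I.splitEquiv (.inr j))) ∈ E j} := by
    ext δ
    rw [mem_ofPred_eq, compresses_iff hm hG hRI, mem_ofPred_eq, and_iff_right (mem_univ _)]
    refine forall_congr' fun j => ?_
    by_cases hj : j.1 ∈ R.1 <;> simp [E, hj]
  rw [hset]
  refine ⟨(pi_measure_block P I.splitEquiv .univ hE).1, ?_⟩
  rw [measureReal_pi_block P I.splitEquiv .univ hE, setIntegral_univ]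
  refine integral_congr_ae (Eventually.of_forall fun x => ?_)
  have hj (j : {i // i ∉ I.1}) : P.real (Prod.mk x ⁻¹' E j) =
      if j.1 ∈ R.1 then 1 else 1 - compErr P T G x := by
    dsimp only [E]
    split_ifs
    · simp
    · exact measureReal_disagreement_compl hD x
  simp_rw [hj]
  rw [prod_ite_mem_of_disjoint hRI, one_pow, one_mul]

/-- Given the samples in `I`, each index in `R` contributes a factor `V` and each remaining index a
factor `1 - V`. -/
theorem measure_compresses_violates {m : ℕ} (hm : d + r ≤ m) (hG : RelaxedConsistency P T d r G)
    (hD : MeasurableSet (disagreement T G)) (ε : ℝ)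
    {R : IdxSet m r} {I : IdxSet m d} (hRI : Disjoint I.1 R.1) :
    (Measure.pi fun _ : Fin m => P).real {δ | Compresses G (labeled T δ) R I ∧
      Violates G (labeled T δ) R I ∧ ε < err P T (hyp G (labeled T δ) I)} =
      ∫ x in {x | ε < compErr P T G x}, compErr P T G x ^ r *
        (1 - compErr P T G x) ^ (m - r - d) ∂(Measure.pi fun _ : Fin d => P) := by
  classical
  let E : {i // i ∉ I.1} → Set ((Fin d → Δ) × Δ) :=
    fun j => if j.1 ∈ R.1 then disagreement T G else (disagreement T G)ᶜ
  have hE (j) : MeasurableSet (E j) := by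
    dsimp only [E]
    split_ifs
    exacts [hD, hD.compl]
  have hB : MeasurableSet {x | ε < compErr P T G x} :=
    measurableSet_lt measurable_const (measurable_compErr hD)
  have hset : {δ : Fin m → Δ | Compresses G (labeled T δ) R I ∧
      Violates G (labeled T δ) R I ∧ ε < err P T (hyp G (labeled T δ) I)} =
      {δ | (fun a => δ (I.splitEquiv (.inl a))) ∈ {x | ε < compErr P T G x} ∧
        ∀ j, ((fun a => δ (I.splitEquiv (.inl a))), δ (I.splitEquiv (.inr j))) ∈ E j} := by
    ext δ
    rw [mem_ofPred_eq, compresses_iff hm hG hRI, mem_ofPred_eq]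
    have hV : Violates G (labeled T δ) R I ↔ ∀ j : {i // i ∉ I.1}, j.1 ∈ R.1 →
        ((fun a => δ (I.splitEquiv (.inl a))), δ (I.splitEquiv (.inr j))) ∈ disagreement T G :=
      ⟨fun h j hj => h j.1 hj, fun h i hi => h ⟨i, Finset.disjoint_right.1 hRI hi⟩ hi⟩
    have hall : (∀ j : {i // i ∉ I.1},
        ((fun a => δ (I.splitEquiv (.inl a))), δ (I.splitEquiv (.inr j))) ∈ E j) ↔
        ∀ j : {i // i ∉ I.1}, (j.1 ∉ R.1 →
          ((fun a => δ (I.splitEquiv (.inl a))), δ (I.splitEquiv (.inr j))) ∈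
            (disagreement T G)ᶜ) ∧ (j.1 ∈ R.1 →
          ((fun a => δ (I.splitEquiv (.inl a))), δ (I.splitEquiv (.inr j))) ∈
            disagreement T G) := by
      refine forall_congr' fun j => ?_
      by_cases hj : j.1 ∈ R.1 <;> simp [E, hj]
    rw [hV, hall, forall_and, ← and_assoc, and_comm]
    rfl
  rw [hset, measureReal_pi_block P I.splitEquiv hB hE]
  refine integral_congr_ae (Eventually.of_forall fun x => ?_)
  have hj (j : {i // i ∉ I.1}) : P.real (Prod.mk x ⁻¹' E j) =
      if j.1 ∈ R.1 then compErr P T G x else 1 - compErr P T G x := by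
    dsimp only [E]
    split_ifs
    · rfl
    · exact measureReal_disagreement_compl hD x
  simp_rw [hj]
  rw [prod_ite_mem_of_disjoint hRI]

/-! ### Moment identity and union bound -/

theorem card_disjoint_idxSet {m : ℕ} (R : IdxSet m r) :
    (Finset.univ.filter fun I : IdxSet m d => Disjoint I.1 R.1).card = (m - r).choose d := by
  classical
  have h : (Finset.univ.filter fun I : IdxSet m d => Disjoint I.1 R.1).map
      (Function.Embedding.subtype _) = Finset.powersetCard d (R.1)ᶜ := by
    ext I
    simp only [Finset.mem_map, Finset.mem_filter, Finset.mem_univ, true_and,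
      Finset.mem_powersetCard, Function.Embedding.subtype_apply, Subtype.exists]
    constructor
    · rintro ⟨J, hJ, hd, rfl⟩
      exact ⟨Finset.subset_compl_iff_disjoint_right.2 hd, hJ⟩
    · rintro ⟨hd, hJ⟩
      exact ⟨I, hJ, Finset.subset_compl_iff_disjoint_right.1 hd, rfl⟩
  rw [← Finset.card_map, h, Finset.card_powersetCard, Finset.card_compl, R.2, Fintype.card_fin]

theorem choose_mul_integral_pow (hG : UniqueRelaxedConsistency P T d r G)
    (hD : MeasurableSet (disagreement T G)) (k : ℕ) :
    ((k + d).choose d : ℝ) *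
      ∫ x, (1 - compErr P T G x) ^ k ∂(Measure.pi fun _ : Fin d => P) = 1 := by
  -- This sample size leaves exactly `k` indices outside `I` and `R`.
  obtain ⟨m, hm⟩ : ∃ m, m = k + d + r := ⟨_, rfl⟩
  have hdr : d + r ≤ m := by omega
  obtain ⟨R, -, hR⟩ := Finset.exists_subset_card_eq
    (s := (Finset.univ : Finset (Fin m))) (n := r) (by simp; omega)
  let R : IdxSet m r := ⟨R, hR⟩
  let S : IdxSet m d → Set (Fin m → Δ) := fun I => {δ | Compresses G (labeled T δ) R I}
  let F := Finset.univ.filter fun I : IdxSet m d => Disjoint I.1 R.1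
  have hF {I : IdxSet m d} (hI : I ∈ F) : Disjoint I.1 R.1 := (Finset.mem_filter.1 hI).2
  have hdisj : Set.Pairwise (F : Set (IdxSet m d))
      (Function.onFun (AEDisjoint (Measure.pi fun _ : Fin m => P)) S) := by
    intro I _ I' _ hne
    rw [Function.onFun, AEDisjoint, measure_eq_zero_iff_ae_notMem]
    filter_upwards [hG.unique_compression m hdr] with δ hδ hmem
    exact hne (hδ R I I' hmem.1 hmem.2)
  have hU := measure_biUnion_finset₀ hdisj fun I hI =>
    (measure_compresses hdr hG.toRelaxedConsistency hD (hF hI)).1.nullMeasurableSet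
  have hone : (Measure.pi fun _ : Fin m => P) (⋃ I ∈ F, S I) = 1 := by
    rw [← measure_univ (μ := Measure.pi fun _ : Fin m => P)]
    refine measure_congr (eventuallyEq_univ.2 ?_)
    filter_upwards [hG.exists_compression m hdr] with δ hδ
    obtain ⟨I, hI⟩ := hδ R
    exact mem_biUnion (Finset.mem_coe.2 (Finset.mem_filter.2 ⟨Finset.mem_univ I, hI.1⟩)) hI
  rw [hone] at hU
  have hU' := congrArg ENNReal.toReal hU
  have hS : ∀ I ∈ F, ((Measure.pi fun _ : Fin m => P) (S I)).toReal = _ := fun I hI =>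
    (measure_compresses hdr hG.toRelaxedConsistency hD (hF hI)).2
  rw [ENNReal.toReal_sum fun I _ => measure_ne_top _ _, Finset.sum_congr rfl hS, Finset.sum_const,
    card_disjoint_idxSet, nsmul_eq_mul, ENNReal.toReal_one] at hU'
  rw [show k + d = m - r by omega, show k = m - r - d by omega]
  exact hU'.symm

theorem errProb_le_of_isSampleAndDiscard (hG : UniqueRelaxedConsistency P T d r G)
    (hD : MeasurableSet (disagreement T G)) {A : Algorithm Δ}
    (hA : IsSampleAndDiscard T d r G A) (ε : ℝ) {m : ℕ} (hm : d + r ≤ m) :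
    errProb P T A m ε ≤ (m.choose r * (m - r).choose d : ℕ) *
      ∫ x in {x | ε < compErr P T G x}, compErr P T G x ^ r *
        (1 - compErr P T G x) ^ (m - r - d) ∂(Measure.pi fun _ : Fin d => P) := by
  let S : (R : IdxSet m r) → IdxSet m d → Set (Fin m → Δ) := fun R I =>
    {δ | Compresses G (labeled T δ) R I ∧ Violates G (labeled T δ) R I ∧
      ε < err P T (hyp G (labeled T δ) I)}
  let F : IdxSet m r → Finset (IdxSet m d) :=
    fun R => Finset.univ.filter fun I : IdxSet m d => Disjoint I.1 R.1
  -- The left-hand set may fail to be measurable; monotonicity of the outer measure suffices.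
  have hsub : {δ : Fin m → Δ | ε < err P T (A m (labeled T δ))}
      ≤ᵐ[Measure.pi fun _ : Fin m => P] ⋃ R ∈ (Finset.univ : Finset (IdxSet m r)),
        ⋃ I ∈ F R, S R I := by
    filter_upwards [hG.exists_compression m hm, hG.exists_discard m hm] with δ h1 h2 hδ
    obtain ⟨R, I, hc, hv, hA'⟩ := hA m hm δ h1 h2
    refine mem_biUnion (Finset.mem_coe.2 (Finset.mem_univ R)) (mem_biUnion
      (Finset.mem_coe.2 (Finset.mem_filter.2 ⟨Finset.mem_univ I, hc.1⟩)) ⟨hc, hv, ?_⟩)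
    rw [← hA']
    exact hδ
  calc errProb P T A m ε
      ≤ (Measure.pi fun _ : Fin m => P).real
          (⋃ R ∈ (Finset.univ : Finset (IdxSet m r)), ⋃ I ∈ F R, S R I) :=
        ENNReal.toReal_mono (measure_ne_top _ _) (measure_mono_ae hsub)
    _ ≤ ∑ R : IdxSet m r, ∑ I ∈ F R, (Measure.pi fun _ : Fin m => P).real (S R I) :=
        (measureReal_biUnion_finset_le _ _).trans
          (Finset.sum_le_sum fun R _ => measureReal_biUnion_finset_le _ _)
    _ = _ := by
        have hS (R) : ∀ I ∈ F R, (Measure.pi fun _ : Fin m => P).real (S R I) = _ := fun I hI =>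
          measure_compresses_violates hm hG.toRelaxedConsistency hD ε (Finset.mem_filter.1 hI).2
        have hcard (R) : (F R).card = (m - r).choose d := card_disjoint_idxSet R
        rw [Finset.sum_congr rfl fun R _ => (Finset.sum_congr rfl (hS R)).trans
          (Finset.sum_const _)]
        simp_rw [hcard]
        rw [Finset.sum_const, Finset.card_univ, Fintype.card_finset_len, Fintype.card_fin, nsmul_eq_mul,
          nsmul_eq_mul]
        push_cast
        ring

end

/-! ### The beta law of the accuracy -/

/-- The distribution on the unit interval with density `(e + 1) * (1 - x) ^ e`. -/
noncomputable def compLaw (e : ℕ) : Measure unitInterval :=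
  volume.withDensity fun x => ENNReal.ofReal ((e + 1) * (1 - (x : ℝ)) ^ e)

theorem setIntegral_compLaw (e : ℕ) {w : ℝ} (hw : w ∈ Icc (0 : ℝ) 1) (g : ℝ → ℝ) :
    ∫ x in {x : unitInterval | (x : ℝ) ≤ w}, g x ∂(compLaw e) =
      ∫ x in (0 : ℝ)..w, (e + 1) * (1 - x) ^ e * g x := by
  have hm : MeasurableSet {x : unitInterval | (x : ℝ) ≤ w} :=
    measurableSet_le measurable_subtype_coe measurable_const
  rw [compLaw, setIntegral_withDensity_eq_setIntegral_toReal_smul (by fun_prop)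
    (Eventually.of_forall fun _ => ENNReal.ofReal_lt_top) _ hm]
  have h1 (x : unitInterval) : (ENNReal.ofReal ((e + 1) * (1 - (x : ℝ)) ^ e)).toReal • g x =
      (fun x : ℝ => (e + 1) * (1 - x) ^ e * g x) x := by
    have : 0 ≤ 1 - (x : ℝ) := sub_nonneg.2 x.2.2
    rw [ENNReal.toReal_ofReal (by positivity), smul_eq_mul]
  simp_rw [h1]
  have h2 := unitInterval.measurePreserving_coe.setIntegral_preimage_emb
    unitInterval.measurableEmbedding_coe (fun x : ℝ => (e + 1) * (1 - x) ^ e * g x) (Iic w)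
  have h3 : Iic w ∩ unitInterval = Icc 0 w := by
    ext x
    simp only [mem_inter_iff, mem_Iic, mem_Icc]
    exact ⟨fun h => ⟨h.2.1, h.1⟩, fun h => ⟨h.2, h.1, h.2.trans hw.2⟩⟩
  rw [Measure.restrict_restrict measurableSet_Iic, h3, integral_Icc_eq_integral_Ioc,
    ← intervalIntegral.integral_of_le hw.1] at h2
  exact h2

/-- The complete beta integral; these are the moments that `choose_mul_integral_pow` yields for `d =
e + 1`. -/
theorem integral_compLaw_pow (e k : ℕ) :
    ((k + (e + 1)).choose (e + 1) : ℝ) * ∫ x : unitInterval, (x : ℝ) ^ k ∂(compLaw e) = 1 := by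
  have h := setIntegral_compLaw e (w := 1) ⟨zero_le_one, le_rfl⟩ (fun x => x ^ k)
  have huniv : {x : unitInterval | (x : ℝ) ≤ 1} = univ := eq_univ_of_forall fun x => x.2.2
  rw [huniv, setIntegral_univ] at h
  simp_rw [mul_assoc] at h
  have hc : ((k + (e + 1)).choose (e + 1) : ℝ) * (e + 1) =
      (e + k + 1 : ℕ) * ((e + k).choose e : ℝ) := by
    rw [add_comm e k]
    exact_mod_cast (Nat.add_one_mul_choose_eq (k + e) e).symm
  rw [h, intervalIntegral.integral_const_mul, ← mul_assoc, hc, integral_one_sub_pow_mul_pow,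
    binomialTail_one]

instance (e : ℕ) : IsFiniteMeasure (compLaw e) := by
  refine isFiniteMeasure_withDensity_ofReal ?_
  exact ((BoundedContinuousFunction.mkOfCompact
    (⟨fun x : unitInterval => (e + 1) * (1 - (x : ℝ)) ^ e, by fun_prop⟩ :
      C(unitInterval, ℝ))).integrable volume).2

/-- With `m = r + e + n + 1` and `d = e + 1`, this turns the number of pairs `(R, I)` times the
density constant `d` into `C(r + d - 1, r)` times the normalization of the beta integral. -/
theorem choose_mul_choose_mul (r e n : ℕ) :
    (r + e + n + 1).choose r * (e + n + 1).choose (e + 1) * (e + 1) =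
      (r + e).choose r * ((r + e + n + 1) * (r + e + n).choose (r + e)) := by
  have h1 : (e + n + 1) * (e + n).choose e = (e + n + 1).choose (e + 1) * (e + 1) :=
    Nat.add_one_mul_choose_eq (e + n) e
  have h2 : (r + e + n).choose r * (r + e + n + 1) = (r + e + n + 1).choose r * (e + n + 1) := by
    have := Nat.choose_mul_succ_eq (r + e + n) r
    rwa [show r + e + n + 1 - r = e + n + 1 by omega] at this
  have h3 := Nat.choose_mul (n := r + e + n) (k := r + e) (s := r) (by omega)
  rw [show r + e + n - r = e + n by omega, show r + e - r = e by omega] at h3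
  calc _ = (r + e + n + 1).choose r * ((e + n + 1).choose (e + 1) * (e + 1)) := by ring
    _ = (r + e + n + 1).choose r * (e + n + 1) * (e + n).choose e := by rw [← h1]; ring
    _ = (r + e + n + 1) * ((r + e + n).choose r * (e + n).choose e) := by rw [← h2]; ring
    _ = _ := by rw [← h3]; ring

variable {d r : ℕ} {P : Measure Δ} [IsProbabilityMeasure P]
  {T : Concept Δ}

section

variable {G : (Fin d → Δ × Bool) → Concept Δ}

/-- The accuracy of the hypothesis compressed from the sample `x`. -/
noncomputable def compAccuracy (P : Measure Δ) [IsProbabilityMeasure P] (T : Concept Δ)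
    (G : (Fin d → Δ × Bool) → Concept Δ) (x : Fin d → Δ) : unitInterval :=
  ⟨1 - compErr P T G x, sub_nonneg.2 (compErr_le_one x), sub_le_self _ (compErr_nonneg x)⟩

theorem measurable_compAccuracy (hD : MeasurableSet (disagreement T G)) :
    Measurable (compAccuracy P T G) :=
  ((measurable_compErr hD).const_sub 1).subtype_mk

end

theorem map_compAccuracy {e : ℕ} {G : (Fin (e + 1) → Δ × Bool) → Concept Δ}
    (hG : UniqueRelaxedConsistency P T (e + 1) r G) (hD : MeasurableSet (disagreement T G)) :
    (Measure.pi fun _ : Fin (e + 1) => P).map (compAccuracy P T G) = compLaw e := by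
  have := Measure.isProbabilityMeasure_map (μ := Measure.pi fun _ : Fin (e + 1) => P)
    (measurable_compAccuracy (P := P) hD).aemeasurable
  refine measure_unitInterval_ext fun k => ?_
  rw [integral_map (measurable_compAccuracy hD).aemeasurable (by fun_prop)]
  have hc : ((k + (e + 1)).choose (e + 1) : ℝ) ≠ 0 :=
    Nat.cast_ne_zero.2 (Nat.choose_pos (by omega)).ne'
  exact mul_left_cancel₀ hc ((choose_mul_integral_pow hG hD k).trans
    (integral_compLaw_pow e k).symm)

/-- In terms of the accuracy `x = 1 - V`, the density factor `(1 - x) ^ e` merges with `V ^ r` into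
the exponent `r + e`. -/
theorem setIntegral_compErr_pow {e : ℕ} {G : (Fin (e + 1) → Δ × Bool) → Concept Δ}
    (hG : UniqueRelaxedConsistency P T (e + 1) r G) (hD : MeasurableSet (disagreement T G))
    {ε : ℝ} (hε : ε ∈ Ioo (0 : ℝ) 1) (n : ℕ) :
    ∫ x in {x | ε ≤ compErr P T G x}, compErr P T G x ^ r *
      (1 - compErr P T G x) ^ n ∂(Measure.pi fun _ : Fin (e + 1) => P) =
    (e + 1) * ∫ x in (0 : ℝ)..(1 - ε), (1 - x) ^ (r + e) * x ^ n := by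
  have h := setIntegral_compLaw e (w := 1 - ε) ⟨by linarith [hε.2], by linarith [hε.1]⟩
    (fun x => (1 - x) ^ r * x ^ n)
  rw [← map_compAccuracy hG hD, setIntegral_map
    (measurableSet_le measurable_subtype_coe measurable_const) (by fun_prop)
    (measurable_compAccuracy hD).aemeasurable] at h
  have hs : compAccuracy P T G ⁻¹' {x : unitInterval | (x : ℝ) ≤ 1 - ε} =
      {x | ε ≤ compErr P T G x} := by
    ext x
    exact sub_le_sub_iff_left (1 : ℝ)
  rw [hs] at h
  simp only [compAccuracy, sub_sub_cancel] at h
  rw [h, ← intervalIntegral.integral_const_mul]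
  refine intervalIntegral.integral_congr fun x _ => ?_
  ring

/-- For `d = 0` the first moment already gives `E (1 - V) = 1` with `0 ≤ V`. -/
theorem ae_compErr_eq_zero {G : (Fin 0 → Δ × Bool) → Concept Δ}
    (hG : UniqueRelaxedConsistency P T 0 r G) (hD : MeasurableSet (disagreement T G)) :
    ∀ᵐ x ∂(Measure.pi fun _ : Fin 0 => P), compErr P T G x = 0 := by
  have hint : Integrable (compErr P T G) (Measure.pi fun _ : Fin 0 => P) :=
    Integrable.of_mem_Icc 0 1 (measurable_compErr hD).aemeasurable
      (Eventually.of_forall fun x => ⟨compErr_nonneg x, compErr_le_one x⟩)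
  have h := choose_mul_integral_pow hG hD 1
  simp only [pow_one, Nat.choose_zero_right, Nat.cast_one, one_mul] at h
  rw [integral_sub (integrable_const _) hint] at h
  have h0 : ∫ x, compErr P T G x ∂(Measure.pi fun _ : Fin 0 => P) = 0 := by
    simpa using h
  exact (integral_eq_zero_iff_of_nonneg (fun x => compErr_nonneg x) hint).1 h0

theorem errProb_le (G : (Fin d → Δ × Bool) → Concept Δ)
    (hG : UniqueRelaxedConsistency P T d r G)
    (hD : MeasurableSet (disagreement T G)) {A : Algorithm Δ}
    (hA : IsSampleAndDiscard T d r G A) {ε : ℝ} (hε : ε ∈ Ioo (0 : ℝ) 1) {m : ℕ}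
    (hm : d + r ≤ m) :
    errProb P T A m ε ≤ ((r + d - 1).choose r : ℝ) *
      ∑ i ∈ Finset.range (r + d), (m.choose i : ℝ) * ε ^ i * (1 - ε) ^ (m - i) := by
  refine (errProb_le_of_isSampleAndDiscard hG hD hA ε hm).trans ?_
  have hε0 := hε.1
  have hε1 : 0 < 1 - ε := by linarith [hε.2]
  cases d with
  | zero =>
    have hz : ∀ᵐ x ∂(Measure.pi fun _ : Fin 0 => P), x ∉ {x | ε < compErr P T G x} := by
      filter_upwards [ae_compErr_eq_zero hG hD] with x hx
      exact not_lt.2 (hx.trans_le hε0.le)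
    -- The domain of integration is null, so only nonnegativity of the bound is needed; the value of
    -- `r + 0 - 1` is immaterial.
    rw [setIntegral_measure_zero _ (measure_eq_zero_iff_ae_notMem.2 hz), mul_zero]
    positivity
  | succ e =>
    obtain ⟨n, rfl⟩ : ∃ n, m = r + e + n + 1 := ⟨m - (e + 1 + r), by omega⟩
    have hsub : ∫ x in {x | ε < compErr P T G x}, compErr P T G x ^ r *
          (1 - compErr P T G x) ^ n ∂(Measure.pi fun _ : Fin (e + 1) => P) ≤
        ∫ x in {x | ε ≤ compErr P T G x}, compErr P T G x ^ r *
          (1 - compErr P T G x) ^ n ∂(Measure.pi fun _ : Fin (e + 1) => P) := by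
      have hb (x) : compErr P T G x ^ r * (1 - compErr P T G x) ^ n ∈ Icc (0 : ℝ) 1 := by
        have h0 := compErr_nonneg (P := P) (T := T) (G := G) x
        have h1 := compErr_le_one (P := P) (T := T) (G := G) x
        have h2 : 0 ≤ 1 - compErr P T G x := sub_nonneg.2 h1
        exact ⟨by positivity, mul_le_one₀ (pow_le_one₀ h0 h1) (by positivity)
          (pow_le_one₀ h2 (sub_le_self _ h0))⟩
      refine setIntegral_mono_set (Integrable.integrableOn (Integrable.of_mem_Icc 0 1 ?_
        (Eventually.of_forall hb))) (Eventually.of_forall fun x => (hb x).1)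
        (Eventually.of_forall fun x (hx : ε < _) => hx.le)
      exact (((measurable_compErr hD).pow_const r).mul
        (((measurable_compErr hD).const_sub 1).pow_const n)).aemeasurable
    rw [show r + e + n + 1 - r - (e + 1) = n by omega,
      show r + e + n + 1 - r = e + n + 1 by omega, show r + (e + 1) - 1 = r + e by omega]
    refine (mul_le_mul_of_nonneg_left hsub (Nat.cast_nonneg _)).trans_eq ?_
    have htail : ∑ i ∈ Finset.range (r + (e + 1)),
        ((r + e + n + 1).choose i : ℝ) * ε ^ i * (1 - ε) ^ (r + e + n + 1 - i) =
        binomialTail (r + e + n + 1) (r + e) (1 - ε) := by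
      rw [binomialTail, sub_sub_cancel]
      rfl
    rw [setIntegral_compErr_pow hG hD hε, htail, ← integral_one_sub_pow_mul_pow, ← mul_assoc,
      ← mul_assoc]
    congr 1
    exact_mod_cast choose_mul_choose_mul r e n

/-! ### Existence of the algorithm and the PAC conclusion -/

theorem exists_isSampleAndDiscard (T : Concept Δ) (d r : ℕ)
    (G : (Fin d → Δ × Bool) → Concept Δ) : ∃ A : Algorithm Δ, IsSampleAndDiscard T d r G A := by
  classical
  refine ⟨fun m z => if h : ∃ I : IdxSet m d, ∃ R : IdxSet m r,
    Compresses G z R I ∧ Violates G z R I then hyp G z h.choose else T, ?_⟩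
  intro m hm δ h1 h2
  obtain ⟨R, hR⟩ := h2
  obtain ⟨I, hI⟩ := h1 R
  have h : ∃ I : IdxSet m d, ∃ R : IdxSet m r,
    Compresses G (labeled T δ) R I ∧ Violates G (labeled T δ) R I := ⟨I, R, hI, hR I hI⟩
  obtain ⟨R', hc, hv⟩ := h.choose_spec
  exact ⟨R', h.choose, hc, hv, dif_pos h⟩

end CompressionLearning

theorem mainTheorem4 {Δ : Type*} [MeasurableSpace Δ] (P : Measure Δ) [IsProbabilityMeasure P]
    (T : Concept Δ) (d r : ℕ) (G : (Fin d → Δ × Bool) → Concept Δ)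
    (hmeas : MeasurableSet {p : (Fin d → Δ) × Δ | p.2 ∈ (G (labeled T p.1)).1})
    (hG : UniqueRelaxedConsistency P T d r G) :
    (∃ A : Algorithm Δ, IsSampleAndDiscard T d r G A) ∧
    ∀ A : Algorithm Δ, IsSampleAndDiscard T d r G A →
      IsPACT P T (d + r) A ∧
      (∀ ε ∈ Ioo (0 : ℝ) 1, ∀ m, d + r ≤ m →
        errProb P T A m ε ≤ ((r + d - 1).choose r : ℝ) *
          ∑ i ∈ Finset.range (r + d), (m.choose i : ℝ) * ε ^ i * (1 - ε) ^ (m - i)) ∧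
      (∀ ε ∈ Ioo (0 : ℝ) 1, Tendsto (fun m : ℕ => ((r + d - 1).choose r : ℝ) *
          ∑ i ∈ Finset.range (r + d), (m.choose i : ℝ) * ε ^ i * (1 - ε) ^ (m - i))
        atTop (𝓝 0)) := by
  have hD := measurableSet_disagreement hmeas
  refine ⟨exists_isSampleAndDiscard T d r G, fun A hA => ?_⟩
  have hlim : ∀ ε ∈ Ioo (0 : ℝ) 1, Tendsto (fun m : ℕ => ((r + d - 1).choose r : ℝ) *
      ∑ i ∈ Finset.range (r + d), (m.choose i : ℝ) * ε ^ i * (1 - ε) ^ (m - i))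
      atTop (𝓝 0) := fun ε hε => by
    simpa using (tendsto_finsetSum (Finset.range (r + d)) fun i _ =>
      tendsto_choose_mul_pow_mul_pow i hε).const_mul ((r + d - 1).choose r : ℝ)
  have hle : ∀ ε ∈ Ioo (0 : ℝ) 1, ∀ m, d + r ≤ m →
      errProb P T A m ε ≤ ((r + d - 1).choose r : ℝ) *
        ∑ i ∈ Finset.range (r + d), (m.choose i : ℝ) * ε ^ i * (1 - ε) ^ (m - i) :=
    fun ε hε m hm => errProb_le G hG hD hA hε hm
  -- Truncation at `1` keeps the bound in `[0,1]`, as `IsPACT` demands.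
  refine ⟨⟨fun m ε => min 1 (((r + d - 1).choose r : ℝ) *
    ∑ i ∈ Finset.range (r + d), (m.choose i : ℝ) * ε ^ i * (1 - ε) ^ (m - i)), ?_, ?_, ?_⟩,
    hle, hlim⟩
  · intro m ε hε
    have h0 := hε.1
    have h1 : 0 < 1 - ε := sub_pos.2 hε.2
    exact ⟨le_min zero_le_one (by positivity), min_le_left _ _⟩
  · intro ε hε
    simpa using (tendsto_const_nhds (x := (1 : ℝ))).min (hlim ε hε)
  · exact fun ε hε m hm => le_min measureReal_le_one (hle ε hε m hm)
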